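/- Let $n\ge 1$, let $\Sigma_n$ be the group of permutations of $\{1,\dots,n\}$ (with $(\sigma\tau)(i)=\sigma(\tau(i))$), and for a partition $\lambda\vdash n$ let $\rho_\lambda$ be Young's orthogonal representation: the real matrix representation of $\Sigma_n$, with rows and columns indexed by the standard tableaux of shape $\lambda$, in which, for every adjacent transposition $s_k=(k\;\,k{+}1)$ and every standard tableau $T$, the entry of $\rho_\lambda(s_k)$ at $(T,T)$ is $1/d$ and, if the tableau $s_kT$ obtained from $T$ by exchanging $k$ and $k+1$ is standard, the entry at $(T,s_kT)$ is $\sqrt{1-1/d^2}$, all other entries being $0$; here $d=c_T(k+1)-c_T(k)$ and $c_T(m)$ is the column index minus the row index of the cell of $T$ that contains $m$. The Fourier coefficient of $f:\Sigma_n\to\mathbb{R}$ at $\lambda$ is the matrix $\hat f_\lambda=\sum_{\sigma\in\Sigma_n} f(\sigma)\,\rho_\lambda(\sigma)$. The objective function of the (not necessarily symmetric) Traveling Salesman Problem with distance matrix $D=[d_{ij}]\in\mathbb{R}^{n\times n}$ is $$f(\sigma)=d_{\sigma(n)\sigma(1)}+\sum_{i=1}^{n-1}d_{\sigma(i)\sigma(i+1)}.$$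 Theorem (Fourier coefficients of the Traveling Salesman Problem). Let $\lambda\vdash n$. 1. If $\lambda$ is none of $(n)$, $(n-2,2)$, $(n-2,1,1)$, then $\hat f_\lambda=0$ for every TSP objective function $f$ on $\Sigma_n$. 2. If $\lambda=(n-2,2)$ (with $n\ge4$) or $\lambda=(n-2,1,1)$ (with $n\ge3$), then $\hat f_\lambda$ has rank at most one for every TSP objective function $f$ on $\Sigma_n$. Moreover, the proportions among the columns of $\hat f_\lambda$ are the same for all instances: there is a nonzero row vector $a=(a_T)_T$ that depends only on $n$ and $\lambda$ such that, for every TSP objective function $f$ on $\Sigma_n$, there is a column vector $w$ for which the column of $\hat f_\lambda$ indexed by $T$ equals $a_T\,w$, for every standard tableau $T$ of shape $\lambda$. -/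

import Mathlib

/-! ### Standard tableaux -/

/-- A filling `T` of the Young diagram `μ` with the numbers `0, …, n - 1`, each used exactly once
(`T k` is the cell that contains `k`; a cell is a pair (row, column)), is *standard* if its entries
increase from left to right along each row and from top to bottom along each column. -/
def IsStandard {n : ℕ} {μ : YoungDiagram} (T : Fin n ≃ μ.cells) : Prop :=
  (∀ a b : Fin n, (T a).1.1 = (T b).1.1 → (T a).1.2 < (T b).1.2 → a < b) ∧
  (∀ a b : Fin n, (T a).1.2 = (T b).1.2 → (T a).1.1 < (T b).1.1 → a < b)

/-- The standard tableaux of shape `μ` (there are none unless `μ` has exactly `n` cells). -/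
abbrev StandardTableau (n : ℕ) (μ : YoungDiagram) : Type :=
  {T : Fin n ≃ μ.cells // IsStandard T}

noncomputable instance (n : ℕ) (μ : YoungDiagram) : Fintype (StandardTableau n μ) := by
  classical exact inferInstance

noncomputable instance (n : ℕ) (μ : YoungDiagram) : DecidableEq (StandardTableau n μ) :=
  Classical.decEq _

/-- The content (column index minus row index) of the cell that contains `a`. -/
def content {n : ℕ} {μ : YoungDiagram} (T : Fin n ≃ μ.cells) (a : Fin n) : ℤ :=
  ((T a).1.2 : ℤ) - ((T a).1.1 : ℤ)

/-- The filling obtained from `T` by exchanging the entries `i` and `j`. -/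
def swapEntries {n : ℕ} {μ : YoungDiagram} (i j : Fin n) (T : Fin n ≃ μ.cells) :
    Fin n ≃ μ.cells :=
  (Equiv.swap i j).trans T

/-- Young's orthogonal matrix of the adjacent transposition `(i j)`, `j = i + 1`. With
`d = content of j in T - content of i in T`, the diagonal entry at `T` is `1 / d`, and the entry
at `(T, U)` is `√(1 - 1 / d²)` if `U` arises from `T` by exchanging `i` and `j`; all other
entries are `0`. -/
noncomputable def yorAdj {n : ℕ} (μ : YoungDiagram) (i j : Fin n) :
    Matrix (StandardTableau n μ) (StandardTableau n μ) ℝ :=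
  open Classical in
  Matrix.of fun T U =>
    if U = T then 1 / ((content T.1 j - content T.1 i : ℤ) : ℝ)
    else if U.1 = swapEntries i j T.1 then
      √(1 - 1 / ((content T.1 j - content T.1 i : ℤ) : ℝ) ^ 2)
    else 0

/-! ### Presentation of the symmetric group by adjacent transpositions -/

/-- A family of elements that satisfies the Coxeter relations of the adjacent transpositions extends
to a homomorphism on the symmetric group. -/
theorem exists_hom_of_coxeter {n : ℕ} {M : Type*} [Monoid M] (g : Fin n → Fin n → M)
    (sq : ∀ i j : Fin n, (j : ℕ) = i + 1 → g i j * g i j = 1)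
    (comm : ∀ i j k l : Fin n, (j : ℕ) = i + 1 → (l : ℕ) = k + 1 → (j : ℕ) < k →
      g i j * g k l = g k l * g i j)
    (braid : ∀ i j k : Fin n, (j : ℕ) = i + 1 → (k : ℕ) = j + 1 →
      g i j * g j k * g i j = g j k * g i j * g j k) :
    ∃ f : Equiv.Perm (Fin n) →* M, ∀ i j : Fin n, (j : ℕ) = i + 1 → f (Equiv.swap i j) = g i j := by
  classical
  let m : Equiv.Perm (Fin n) → ℕ := fun σ => ∑ a : Fin n, (n - a) * (σ a : ℕ)
  have hm : ∀ (σ : Equiv.Perm (Fin n)) (i j : Fin n), (j : ℕ) = i + 1 → σ j < σ i →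
      m (σ * Equiv.swap i j) < m σ := by
    intro σ i j hij h
    have hne : j ≠ i := by intro h'; subst h'; omega
    have hj : j ∈ (Finset.univ : Finset (Fin n)).erase i := by simp [hne]
    simp only [m]
    rw [← Finset.add_sum_erase _ _ (Finset.mem_univ i), ← Finset.add_sum_erase _ _ hj,
      ← Finset.add_sum_erase (a := i) _ _ (Finset.mem_univ i),
      ← Finset.add_sum_erase (a := j) _ _ hj]
    have hs : ∑ x ∈ (Finset.univ.erase i).erase j, (n - (x : ℕ)) * ((σ * Equiv.swap i j) x : ℕ)
        = ∑ x ∈ (Finset.univ.erase i).erase j, (n - (x : ℕ)) * (σ x : ℕ) := by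
      refine Finset.sum_congr rfl fun x hx => ?_
      simp only [Finset.mem_erase] at hx
      rw [Equiv.Perm.mul_apply, Equiv.swap_apply_of_ne_of_ne hx.2.1 hx.1]
    rw [hs]
    simp only [Equiv.Perm.mul_apply, Equiv.swap_apply_left, Equiv.swap_apply_right]
    have h' : (σ j : ℕ) < σ i := h
    obtain ⟨t, ht⟩ : ∃ t, n - (i : ℕ) = t + 1 := ⟨n - i - 1, by omega⟩
    have ht' : n - (j : ℕ) = t := by omega
    rw [ht, ht']
    nlinarith
  -- canonical value along descents
  let D : Equiv.Perm (Fin n) → Prop := fun σ => ∃ p : Fin n × Fin n, (p.2 : ℕ) = p.1 + 1 ∧ σ p.2 < σ p.1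
  obtain ⟨N, hN⟩ : ∃ N : Equiv.Perm (Fin n) → M, ∀ σ, N σ = if h : D σ then
      N (σ * Equiv.swap h.choose.1 h.choose.2) * g h.choose.1 h.choose.2 else 1 := by
    refine ⟨WellFounded.fix (measure m).wf (fun σ rec => if h : D σ then
      rec (σ * Equiv.swap h.choose.1 h.choose.2)
        (hm σ _ _ h.choose_spec.1 h.choose_spec.2) * g h.choose.1 h.choose.2 else 1), ?_⟩
    intro σ
    rw [WellFounded.fix_eq]
  have key : ∀ (L : ℕ) (σ : Equiv.Perm (Fin n)), m σ < L → ∀ i j : Fin n, (j : ℕ) = i + 1 → σ j < σ i →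
      N σ = N (σ * Equiv.swap i j) * g i j := by
    intro L
    induction L with
    | zero => intro σ h; omega
    | succ L ih =>
      -- commuting descents
      have hc : ∀ σ : Equiv.Perm (Fin n), m σ < L + 1 → ∀ i j k l : Fin n, (j : ℕ) = i + 1 →
          (l : ℕ) = k + 1 → (j : ℕ) < k → σ j < σ i → σ l < σ k →
          N (σ * Equiv.swap i j) * g i j = N (σ * Equiv.swap k l) * g k l := by
        intro σ hσ i j k l hij hkl hjk h1 h2
        have e1 : Equiv.swap i j k = k := Equiv.swap_apply_of_ne_of_ne (by intro h; subst h; omega) (by intro h; subst h; omega)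
        have e2 : Equiv.swap i j l = l := Equiv.swap_apply_of_ne_of_ne (by intro h; subst h; omega) (by intro h; subst h; omega)
        have e3 : Equiv.swap k l i = i := Equiv.swap_apply_of_ne_of_ne (by intro h; subst h; omega) (by intro h; subst h; omega)
        have e4 : Equiv.swap k l j = j := Equiv.swap_apply_of_ne_of_ne (by intro h; subst h; omega) (by intro h; subst h; omega)
        rw [ih (σ * Equiv.swap i j) (by have := hm σ i j hij h1; omega) k l hkl (by simp [e1, e2, h2]),
          ih (σ * Equiv.swap k l) (by have := hm σ k l hkl h2; omega) i j hij (by simp [e3, e4, h1])]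
        have : Equiv.swap i j * Equiv.swap k l = Equiv.swap k l * Equiv.swap i j := by
          rw [Equiv.mul_swap_eq_swap_mul, e1, e2]
        rw [mul_assoc, mul_assoc, mul_assoc, mul_assoc, this, comm i j k l hij hkl hjk]
      have hb : ∀ σ : Equiv.Perm (Fin n), m σ < L + 1 → ∀ i j k : Fin n, (j : ℕ) = i + 1 →
          (k : ℕ) = j + 1 → σ j < σ i → σ k < σ j →
          N (σ * Equiv.swap i j) * g i j = N (σ * Equiv.swap j k) * g j k := by
        intro σ hσ i j k hij hjk h1 h2
        have n1 : i ≠ j := by intro h; subst h; omega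
        have n2 : j ≠ k := by intro h; subst h; omega
        have n3 : i ≠ k := by intro h; subst h; omega
        have e1 : Equiv.swap i j k = k := Equiv.swap_apply_of_ne_of_ne n3.symm n2.symm
        have e2 : Equiv.swap j k i = i := Equiv.swap_apply_of_ne_of_ne n1 n3
        have l1 := hm σ i j hij h1
        have l2 := hm σ j k hjk h2
        have d1 : (σ * Equiv.swap i j) k < (σ * Equiv.swap i j) j := by simp [e1]; exact h2.trans h1
        have d2 : (σ * Equiv.swap j k) j < (σ * Equiv.swap j k) i := by simp [e2]; exact h2.trans h1
        have l3 := hm _ j k hjk d1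
        have l4 := hm _ i j hij d2
        rw [ih (σ * Equiv.swap i j) (by omega) j k hjk d1, ih (σ * Equiv.swap j k) (by omega) i j hij d2,
          ih (σ * Equiv.swap i j * Equiv.swap j k) (by omega) i j hij (by simp [e1, e2, h2]),
          ih (σ * Equiv.swap j k * Equiv.swap i j) (by omega) j k hjk (by simp [e1, e2, h1])]
        have : Equiv.swap i j * Equiv.swap j k * Equiv.swap i j = Equiv.swap j k * Equiv.swap i j * Equiv.swap j k := by
          rw [Equiv.swap_mul_swap_mul_swap n1 n3, Equiv.swap_comm j k, Equiv.swap_comm i j,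
            Equiv.swap_mul_swap_mul_swap n2.symm n3.symm, Equiv.swap_comm]
        have b := braid i j k hij hjk
        calc _ = N (σ * (Equiv.swap i j * Equiv.swap j k * Equiv.swap i j)) * (g i j * g j k * g i j) := by
              simp only [mul_assoc]
          _ = _ := by rw [this, b]; simp only [mul_assoc]
      intro σ hσ i j hij h
      have hD : D σ := ⟨(i, j), hij, h⟩
      rw [hN σ, dif_pos hD]
      obtain ⟨q1, q2⟩ := hD.choose_spec
      generalize hD.choose = p at q1 q2 ⊢
      obtain ⟨k, l⟩ := p
      simp only at q1 q2 ⊢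
      rcases lt_trichotomy (i : ℕ) k with hlt | heq | hgt
      · by_cases hjk : (j : ℕ) < k
        · exact (hc σ hσ i j k l hij q1 hjk h q2).symm
        · have : j = k := Fin.ext (by omega)
          subst this
          exact (hb σ hσ i j l hij q1 h q2).symm
      · have : i = k := Fin.ext heq
        subst this
        have : j = l := Fin.ext (by omega)
        subst this
        rfl
      · by_cases hlk : (l : ℕ) < i
        · exact hc σ hσ k l i j q1 hij hlk q2 h
        · have : l = i := Fin.ext (by omega)
          subst this
          exact hb σ hσ k l j q1 hij q2 h
  have step : ∀ (σ : Equiv.Perm (Fin n)) (i j : Fin n), (j : ℕ) = i + 1 →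
      N (σ * Equiv.swap i j) = N σ * g i j := by
    intro σ i j hij
    have hne : i ≠ j := by intro h'; subst h'; omega
    rcases lt_or_gt_of_ne (σ.injective.ne hne) with h | h
    · have := key _ (σ * Equiv.swap i j) (Nat.lt_succ_self _) i j hij (by simpa using h)
      simpa [mul_assoc] using this
    · have := key _ σ (Nat.lt_succ_self _) i j hij h
      rw [this, mul_assoc, sq i j hij, mul_one]
  have one : N 1 = 1 := by
    rw [hN, dif_neg]
    rintro ⟨⟨i, j⟩, h1, h2⟩
    have : (j : ℕ) < i := h2
    simp only at h1
    omega
  have mul : ∀ τ σ : Equiv.Perm (Fin n), N (σ * τ) = N σ * N τ := by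
    intro τ
    rcases n with _ | n
    · intro σ
      rw [Subsingleton.elim σ 1, Subsingleton.elim τ 1]; simp [one]
    · have hτ : τ ∈ Submonoid.closure
          (Set.range fun i : Fin n ↦ Equiv.swap i.castSucc i.succ) := by
        rw [Equiv.Perm.mclosure_swap_castSucc_succ]; trivial
      induction hτ using Submonoid.closure_induction_right with
      | one => intro σ; simp [one]
      | mul_right x hx y hy ih =>
        obtain ⟨i, rfl⟩ := hy
        intro σ
        rw [← mul_assoc, step _ _ _ (by simp), step _ _ _ (by simp), ih, mul_assoc]
  refine ⟨⟨⟨N, one⟩, fun σ τ => mul τ σ⟩, fun i j hij => ?_⟩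
  have := step 1 i j hij
  simpa [one] using this

/-! ### Young's orthogonal matrices satisfy the Coxeter relations -/

section YoungOrthogonal

variable {n : ℕ} {μ : YoungDiagram}

theorem IsStandard.le_of_le {T : Fin n ≃ μ.cells} (hT : IsStandard T) {a b : Fin n}
    (h1 : (T a).1.1 ≤ (T b).1.1) (h2 : (T a).1.2 ≤ (T b).1.2) : a ≤ b := by
  have hmem : ((T a).1.1, (T b).1.2) ∈ μ.cells :=
    μ.up_left_mem h1 le_rfl (show ((T b).1.1, (T b).1.2) ∈ μ from (T b).2)
  obtain ⟨c, hc⟩ := T.surjective ⟨_, hmem⟩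
  have hc1 : (T c).1.1 = (T a).1.1 := by rw [hc]
  have hc2 : (T c).1.2 = (T b).1.2 := by rw [hc]
  have hac : a ≤ c := by
    rcases h2.eq_or_lt with h | h
    · refine le_of_eq (T.injective (Subtype.ext (Prod.ext hc1.symm ?_)))
      rw [hc2, h]
    · exact (hT.1 a c hc1.symm (by rw [hc2]; exact h)).le
  have hcb : c ≤ b := by
    rcases h1.eq_or_lt with h | h
    · refine le_of_eq (T.injective (Subtype.ext (Prod.ext ?_ hc2)))
      rw [hc1, h]
    · exact (hT.2 c b hc2 (by rw [hc1]; exact h)).le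
  exact hac.trans hcb

theorem IsStandard.lt_of_le {T : Fin n ≃ μ.cells} (hT : IsStandard T) {a b : Fin n}
    (h1 : (T a).1.1 ≤ (T b).1.1) (h2 : (T a).1.2 ≤ (T b).1.2) (h : (T a).1 ≠ (T b).1) :
    a < b :=
  lt_of_le_of_ne (hT.le_of_le h1 h2) (by rintro rfl; exact h rfl)

/-- Two cells on one diagonal have entries that differ by at least three. -/
theorem IsStandard.three_le_of_content_eq {T : Fin n ≃ μ.cells} (hT : IsStandard T) {a b : Fin n}
    (hab : a < b) (h : content T a = content T b) : (a : ℕ) + 3 ≤ b := by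
  simp only [content] at h
  have hlt : (T a).1.1 < (T b).1.1 := by
    by_contra hn
    push Not at hn
    have := hT.le_of_le (a := b) (b := a) hn (by omega)
    omega
  have hlt2 : (T a).1.2 < (T b).1.2 := by omega
  have hb : ((T b).1.1, (T b).1.2) ∈ μ := (T b).2
  obtain ⟨c, hc⟩ := T.surjective ⟨((T a).1.1, (T b).1.2), μ.up_left_mem hlt.le le_rfl hb⟩
  obtain ⟨d, hd⟩ := T.surjective ⟨((T b).1.1, (T a).1.2), μ.up_left_mem le_rfl hlt2.le hb⟩
  have hc1 : (T c).1.1 = (T a).1.1 := by rw [hc]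
  have hc2 : (T c).1.2 = (T b).1.2 := by rw [hc]
  have hd1 : (T d).1.1 = (T b).1.1 := by rw [hd]
  have hd2 : (T d).1.2 = (T a).1.2 := by rw [hd]
  have h1 : a < c := hT.1 a c hc1.symm (by omega)
  have h2 : c < b := hT.2 c b hc2 (by omega)
  have h3 : a < d := hT.2 a d hd2.symm (by omega)
  have h4 : d < b := hT.1 d b hd1 (by omega)
  have h5 : c ≠ d := by rintro rfl; omega
  have h6 : (c : ℕ) ≠ d := fun h => h5 (Fin.ext h)
  simp only [Fin.lt_def] at h1 h2 h3 h4
  omega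

/-- If exchanging `i` and `i + 1` destroys standardness, the two entries are adjacent in a row or
in a column. -/
theorem IsStandard.content_sub_of_not {T : Fin n ≃ μ.cells} (hT : IsStandard T) {i j : Fin n}
    (hij : (j : ℕ) = i + 1) (h : ¬ IsStandard (swapEntries i j T)) :
    content T j - content T i = 1 ∨ content T j - content T i = -1 := by
  have hiff : ∀ a b : Fin n, a < b → ¬ (Equiv.swap i j a < Equiv.swap i j b) → a = i ∧ b = j := by
    intro a b hab hn
    have hi : ∀ x : Fin n, x = i ↔ (x : ℕ) = i := fun x => Fin.ext_iff
    have hj : ∀ x : Fin n, x = j ↔ (x : ℕ) = j := fun x => Fin.ext_iff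
    rw [Equiv.swap_apply_def, Equiv.swap_apply_def] at hn
    rw [hi, hj]
    simp only [Fin.lt_def] at hab hn
    split_ifs at hn <;> simp_all [Fin.ext_iff] <;> omega
  have hbetween : ∀ c : Fin n, i < c → c < j → False := by
    intro c h1 h2
    simp only [Fin.lt_def] at h1 h2
    omega
  have hj : ((T j).1.1, (T j).1.2) ∈ μ := (T j).2
  simp only [IsStandard, not_and_or, not_forall] at h
  rcases h with ⟨a, b, h1, h2, h3⟩ | ⟨a, b, h1, h2, h3⟩
  · left
    simp only [swapEntries, Equiv.trans_apply] at h1 h2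
    have hlt := hT.1 _ _ h1 h2
    obtain ⟨e1, e2⟩ := hiff _ _ hlt (by simpa using h3)
    rw [e1, e2] at h1 h2
    simp only [content]
    by_contra hne
    obtain ⟨c, hc⟩ := T.surjective ⟨((T j).1.1, (T i).1.2 + 1),
      μ.up_left_mem le_rfl (by omega) hj⟩
    have hc1 : (T c).1.1 = (T j).1.1 := by rw [hc]
    have hc2 : (T c).1.2 = (T i).1.2 + 1 := by rw [hc]
    exact hbetween c (hT.1 _ _ (by omega) (by omega)) (hT.1 _ _ (by omega) (by omega))
  · right
    simp only [swapEntries, Equiv.trans_apply] at h1 h2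
    have hlt := hT.2 _ _ h1 h2
    obtain ⟨e1, e2⟩ := hiff _ _ hlt (by simpa using h3)
    rw [e1, e2] at h1 h2
    simp only [content]
    by_contra hne
    obtain ⟨c, hc⟩ := T.surjective ⟨((T i).1.1 + 1, (T j).1.2),
      μ.up_left_mem (by omega) le_rfl hj⟩
    have hc1 : (T c).1.1 = (T i).1.1 + 1 := by rw [hc]
    have hc2 : (T c).1.2 = (T j).1.2 := by rw [hc]
    exact hbetween c (hT.2 _ _ (by omega) (by omega)) (hT.2 _ _ (by omega) (by omega))

/-- The operator of `yorAdj` written on functions of all fillings. -/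
noncomputable def yorFun (i j : Fin n) (w : (Fin n ≃ μ.cells) → ℝ) (T : Fin n ≃ μ.cells) : ℝ :=
  1 / ((content T j - content T i : ℤ) : ℝ) * w T
    + √(1 - 1 / ((content T j - content T i : ℤ) : ℝ) ^ 2) * w (swapEntries i j T)

theorem content_swapEntries (i j a : Fin n) (T : Fin n ≃ μ.cells) :
    content (swapEntries i j T) a = content T (Equiv.swap i j a) := rfl

theorem swapEntries_swapEntries (i j : Fin n) (T : Fin n ≃ μ.cells) :
    swapEntries i j (swapEntries i j T) = T := by
  ext a : 1
  simp [swapEntries]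

theorem swapEntries_ne {i j : Fin n} (hij : i ≠ j) (T : Fin n ≃ μ.cells) :
    swapEntries i j T ≠ T := by
  intro h
  have := congrArg (fun E : Fin n ≃ μ.cells => E i) h
  simp only [swapEntries, Equiv.trans_apply, Equiv.swap_apply_left] at this
  exact hij (T.injective this).symm

theorem yorFun_congr {i j : Fin n} (hij : (j : ℕ) = i + 1) {w w' : (Fin n ≃ μ.cells) → ℝ}
    (h : ∀ T, IsStandard T → w T = w' T) (T : Fin n ≃ μ.cells) (hT : IsStandard T) :
    yorFun i j w T = yorFun i j w' T := by
  unfold yorFun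
  rw [h T hT]
  by_cases hs : IsStandard (swapEntries i j T)
  · rw [h _ hs]
  · rcases hT.content_sub_of_not hij hs with e | e <;> simp [e]

/-- Extension by zero from standard tableaux to all fillings. -/
noncomputable def extendZero (v : StandardTableau n μ → ℝ) (T : Fin n ≃ μ.cells) : ℝ :=
  open Classical in if h : IsStandard T then v ⟨T, h⟩ else 0

theorem extendZero_coe (v : StandardTableau n μ → ℝ) (T : StandardTableau n μ) :
    extendZero v T.1 = v T := by
  simp [extendZero, T.2]

theorem yorAdj_mulVec {i j : Fin n} (hij : (j : ℕ) = i + 1) (v : StandardTableau n μ → ℝ)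
    (T : StandardTableau n μ) :
    (yorAdj μ i j).mulVec v T = yorFun i j (extendZero v) T.1 := by
  classical
  have hne : i ≠ j := by intro h; subst h; omega
  unfold yorFun
  rw [extendZero_coe]
  simp only [Matrix.mulVec, dotProduct, yorAdj, Matrix.of_apply]
  rw [← Finset.add_sum_erase _ _ (Finset.mem_univ T), if_pos rfl]
  congr 1
  by_cases hs : IsStandard (swapEntries i j T.1)
  · have hU : (⟨swapEntries i j T.1, hs⟩ : StandardTableau n μ) ≠ T := fun h =>
      swapEntries_ne hne T.1 (congrArg Subtype.val h)
    rw [Finset.sum_eq_single ⟨swapEntries i j T.1, hs⟩]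
    · simp [hU, extendZero, hs]
    · intro U hU1 hU2
      rw [if_neg (Finset.ne_of_mem_erase hU1), if_neg (fun h => hU2 (Subtype.ext h)), zero_mul]
    · intro h
      simp [hU] at h
  · rw [extendZero, dif_neg hs, mul_zero]
    refine Finset.sum_eq_zero fun U hU => ?_
    rw [if_neg (Finset.ne_of_mem_erase hU), if_neg, zero_mul]
    intro h
    exact hs (h ▸ U.2)

theorem extendZero_yorAdj_mulVec {i j : Fin n} (hij : (j : ℕ) = i + 1)
    (v : StandardTableau n μ → ℝ) (T : Fin n ≃ μ.cells) (hT : IsStandard T) :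
    extendZero ((yorAdj μ i j).mulVec v) T = yorFun i j (extendZero v) T := by
  rw [extendZero, dif_pos hT, yorAdj_mulVec hij]

theorem yor_sq_aux (z : ℤ) : √(1 - 1 / (z : ℝ) ^ 2) ^ 2 = 1 - 1 / (z : ℝ) ^ 2 := by
  refine Real.sq_sqrt ?_
  rcases eq_or_ne z 0 with rfl | hz
  · simp
  · have h1 : (1 : ℤ) ≤ z ^ 2 := by
      have := sq_pos_of_ne_zero hz
      omega
    have h2 : (1 : ℝ) ≤ (z : ℝ) ^ 2 := by exact_mod_cast h1
    rw [sub_nonneg, div_le_one (by positivity)]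
    exact h2

theorem yorFun_sq {i j : Fin n} (w : (Fin n ≃ μ.cells) → ℝ) (T : Fin n ≃ μ.cells) :
    yorFun i j (yorFun i j w) T = w T := by
  unfold yorFun
  simp only [content_swapEntries, Equiv.swap_apply_left, Equiv.swap_apply_right,
    swapEntries_swapEntries]
  have e : content T i - content T j = -(content T j - content T i) := by ring
  rw [e]
  generalize content T j - content T i = z
  have h := yor_sq_aux z
  push_cast
  rw [neg_sq]
  linear_combination (w T) * h

theorem yorFun_comm {i j k l : Fin n} (hij : (j : ℕ) = i + 1) (hkl : (l : ℕ) = k + 1)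
    (hjk : (j : ℕ) < k) (w : (Fin n ≃ μ.cells) → ℝ) (T : Fin n ≃ μ.cells) :
    yorFun i j (yorFun k l w) T = yorFun k l (yorFun i j w) T := by
  have e1 : Equiv.swap i j k = k :=
    Equiv.swap_apply_of_ne_of_ne (by intro h; subst h; omega) (by intro h; subst h; omega)
  have e2 : Equiv.swap i j l = l :=
    Equiv.swap_apply_of_ne_of_ne (by intro h; subst h; omega) (by intro h; subst h; omega)
  have e3 : Equiv.swap k l i = i :=
    Equiv.swap_apply_of_ne_of_ne (by intro h; subst h; omega) (by intro h; subst h; omega)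
  have e4 : Equiv.swap k l j = j :=
    Equiv.swap_apply_of_ne_of_ne (by intro h; subst h; omega) (by intro h; subst h; omega)
  have e5 : swapEntries k l (swapEntries i j T) = swapEntries i j (swapEntries k l T) := by
    have : Equiv.swap k l * Equiv.swap i j = Equiv.swap i j * Equiv.swap k l := by
      rw [Equiv.mul_swap_eq_swap_mul, e3, e4]
    ext a : 1
    have h := congrArg (fun E : Equiv.Perm (Fin n) => E a) this
    simp only [Equiv.Perm.mul_apply] at h
    simp only [swapEntries, Equiv.trans_apply, h]
  unfold yorFun
  simp only [content_swapEntries, e1, e2, e3, e4, e5]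
  ring

theorem yorFun_braid {i j k : Fin n} (hij : (j : ℕ) = i + 1) (hjk : (k : ℕ) = j + 1)
    (w : (Fin n ≃ μ.cells) → ℝ) (T : Fin n ≃ μ.cells) (hT : IsStandard T) :
    yorFun i j (yorFun j k (yorFun i j w)) T = yorFun j k (yorFun i j (yorFun j k w)) T := by
  have n1 : i ≠ j := by intro h; subst h; omega
  have n2 : j ≠ k := by intro h; subst h; omega
  have n3 : i ≠ k := by intro h; subst h; omega
  have e1 : Equiv.swap i j k = k := Equiv.swap_apply_of_ne_of_ne n3.symm n2.symm
  have e2 : Equiv.swap j k i = i := Equiv.swap_apply_of_ne_of_ne n1 n3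
  have e5 : swapEntries i j (swapEntries j k (swapEntries i j T))
      = swapEntries j k (swapEntries i j (swapEntries j k T)) := by
    have : Equiv.swap i j * Equiv.swap j k * Equiv.swap i j
        = Equiv.swap j k * Equiv.swap i j * Equiv.swap j k := by
      rw [Equiv.swap_mul_swap_mul_swap n1 n3, Equiv.swap_comm j k, Equiv.swap_comm i j,
        Equiv.swap_mul_swap_mul_swap n2.symm n3.symm, Equiv.swap_comm]
    ext a : 1
    have h := congrArg (fun E : Equiv.Perm (Fin n) => E a) this
    simp only [Equiv.Perm.mul_apply] at h
    simp only [swapEntries, Equiv.trans_apply, h]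
  have hp : content T j - content T i ≠ 0 := fun h => by
    have := hT.three_le_of_content_eq (a := i) (b := j) (by rw [Fin.lt_def]; omega) (by omega)
    omega
  have hq : content T k - content T j ≠ 0 := fun h => by
    have := hT.three_le_of_content_eq (a := j) (b := k) (by rw [Fin.lt_def]; omega) (by omega)
    omega
  have hr : content T k - content T i ≠ 0 := fun h => by
    have := hT.three_le_of_content_eq (a := i) (b := k) (by rw [Fin.lt_def]; omega) (by omega)
    omega
  unfold yorFun
  simp only [content_swapEntries, Equiv.swap_apply_left, Equiv.swap_apply_right,
    swapEntries_swapEntries, e1, e2, e5]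
  have f1 : content T i - content T j = -(content T j - content T i) := by ring
  have f2 : content T j - content T k = -(content T k - content T j) := by ring
  have f4 : content T k - content T i
    = (content T j - content T i) + (content T k - content T j) := by ring
  rw [f1, f2]
  rw [f4] at hr ⊢
  generalize content T j - content T i = x at *
  generalize content T k - content T j = y at *
  have hx' : (x : ℝ) ≠ 0 := by exact_mod_cast hp
  have hy' : (y : ℝ) ≠ 0 := by exact_mod_cast hq
  have hz' : ((x + y : ℤ) : ℝ) ≠ 0 := by exact_mod_cast hr
  have s1 := yor_sq_aux x
  have s2 := yor_sq_aux y
  simp only [Int.cast_neg, neg_sq]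
  generalize √(1 - 1 / (x : ℝ) ^ 2) = bx at *
  generalize √(1 - 1 / (y : ℝ) ^ 2) = bw at *
  generalize √(1 - 1 / ((x + y : ℤ) : ℝ) ^ 2) = bz at *
  push_cast at *
  have hrel : 1 / ((x : ℝ) + y) * (1 / (x : ℝ) + 1 / y) = 1 / x * (1 / y) := by
    field_simp
    ring
  have g1 : 1 / (-(x : ℝ)) = -(1 / x) := by ring
  have g2 : 1 / (-(y : ℝ)) = -(1 / y) := by ring
  have s1' : bx ^ 2 = 1 - (1 / (x : ℝ)) ^ 2 := by rw [s1]; ring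
  have s2' : bw ^ 2 = 1 - (1 / (y : ℝ)) ^ 2 := by rw [s2]; ring
  simp only [g1, g2]
  clear s1 s2 g1 g2
  generalize 1 / ((x : ℝ) + y) = r at *
  generalize 1 / (x : ℝ) = p at *
  generalize 1 / (y : ℝ) = q at *
  linear_combination (w T * r) * (s1' - s2') - (w T * (p - q)) * hrel
    - (bx * w (swapEntries i j T)) * hrel + (bw * w (swapEntries j k T)) * hrel

theorem matrix_eq_of_mulVec {ι : Type*} [Fintype ι] [DecidableEq ι] {A B : Matrix ι ι ℝ}
    (h : ∀ v : ι → ℝ, A.mulVec v = B.mulVec v) : A = B := by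
  ext a b
  have := congrFun (h (Pi.single b 1)) a
  simpa using this

end YoungOrthogonal

/-- Young's orthogonal matrices of the adjacent transpositions extend to a representation. -/
theorem exists_yor (n : ℕ) (μ : YoungDiagram) :
    ∃ ρ : Equiv.Perm (Fin n) →* Matrix (StandardTableau n μ) (StandardTableau n μ) ℝ,
      ∀ i j : Fin n, (j : ℕ) = i + 1 → ρ (Equiv.swap i j) = yorAdj μ i j := by
  refine exists_hom_of_coxeter (yorAdj μ) ?_ ?_ ?_
  · intro i j hij
    refine matrix_eq_of_mulVec fun v => funext fun T => ?_
    rw [← Matrix.mulVec_mulVec, yorAdj_mulVec hij,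
      yorFun_congr hij (extendZero_yorAdj_mulVec hij v) _ T.2, yorFun_sq, extendZero_coe,
      Matrix.one_mulVec]
  · intro i j k l hij hkl hjk
    refine matrix_eq_of_mulVec fun v => funext fun T => ?_
    rw [← Matrix.mulVec_mulVec, ← Matrix.mulVec_mulVec, yorAdj_mulVec hij, yorAdj_mulVec hkl,
      yorFun_congr hij (extendZero_yorAdj_mulVec hkl v) _ T.2,
      yorFun_congr hkl (extendZero_yorAdj_mulVec hij v) _ T.2, yorFun_comm hij hkl hjk]
  · intro i j k hij hjk
    refine matrix_eq_of_mulVec fun v => funext fun T => ?_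
    simp only [← Matrix.mulVec_mulVec]
    rw [yorAdj_mulVec hij, yorAdj_mulVec hjk,
      yorFun_congr hij (w' := yorFun j k (yorFun i j (extendZero v))) ?_ _ T.2,
      yorFun_congr hjk (w' := yorFun i j (yorFun j k (extendZero v))) ?_ _ T.2,
      yorFun_braid hij hjk _ _ T.2]
    · intro U hU
      rw [extendZero_yorAdj_mulVec hij _ _ hU]
      exact yorFun_congr hij (extendZero_yorAdj_mulVec hjk v) _ hU
    · intro U hU
      rw [extendZero_yorAdj_mulVec hjk _ _ hU]
      exact yorFun_congr hjk (extendZero_yorAdj_mulVec hij v) _ hU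

/-! ### Fourier coefficients and the traveling salesman problem -/

/-- Young's orthogonal representation of the symmetric group on `{0, …, n - 1}` at the partition
with Young diagram `μ`: the representation whose value at each adjacent transposition `(i i+1)` is
Young's orthogonal matrix `yorAdj μ i (i+1)`. It is unique, as these transpositions generate. -/
noncomputable def yor (n : ℕ) (μ : YoungDiagram) :
    Equiv.Perm (Fin n) →* Matrix (StandardTableau n μ) (StandardTableau n μ) ℝ :=
  (exists_yor n μ).choose

theorem yor_swap {n : ℕ} (μ : YoungDiagram) (i j : Fin n) (hij : (j : ℕ) = i + 1) :
    yor n μ (Equiv.swap i j) = yorAdj μ i j :=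
  (exists_yor n μ).choose_spec i j hij

/-- The Fourier coefficient `∑ σ, f σ • ρ σ` of `f` at `μ`, `ρ` being Young's orthogonal
representation. -/
noncomputable def fourierCoefficient {n : ℕ} (f : Equiv.Perm (Fin n) → ℝ) (μ : YoungDiagram) :
    Matrix (StandardTableau n μ) (StandardTableau n μ) ℝ :=
  ∑ σ : Equiv.Perm (Fin n), f σ • yor n μ σ

/-- The objective function of the traveling salesman problem with distance matrix `D`: the length
`∑ d_{σ(i) σ(i+1)}` of the closed tour `σ`. Here `finRotate n` is the cyclic successor
`i ↦ i + 1`, `n - 1 ↦ 0`. -/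
def tspObjective {n : ℕ} (D : Matrix (Fin n) (Fin n) ℝ) (σ : Equiv.Perm (Fin n)) : ℝ :=
  ∑ i : Fin n, D (σ i) (σ (finRotate n i))

/-!
Write `n = m + 1`, and let `ρ` be Young's orthogonal representation of shape `μ`. Every pair of
cyclically consecutive positions `(i, i + 1)` is a rotation of the pair `(m - 1, m)`. Hence the
Fourier coefficient of a tour length factors as `F * C`, where `F = ∑ τ, D (τ (m - 1)) (τ m) • ρ τ`
depends on the instance and `C`, the sum of `ρ` over the rotations, does not. Since `F` is invariant
under right multiplication by the pointwise stabilizer `H` of the two last positions, the coefficient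
even has the form `B * (P * C)` with `P = ∑ h ∈ H, ρ h`
(`fourierCoefficient_tspObjective_eq_mul_stabSum`).

The columns of `P` are fixed by `H`. From the explicit form of Young's matrices, a vector fixed by
the adjacent transpositions of the entries less than `q` is supported on the tableaux that have all
these entries in the first row (`eq_zero_of_fixed`). With `q = n - 2` this leaves:

* no tableau if the first row of `μ` is shorter than `n - 2`, so that `P = 0`;
* exactly one tableau for `(n - 2, 2)` and for `(n - 2, 1, 1)`, so that `P * C` has just one nonzero
  row, and this row gives the common proportions of the columns;
* for `(n - 1, 1)` two tableaux, but there already `C = 0` (`cycleSum_eq_zero`): the tableau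
  with last entry in the second row is a vector `v` fixed by the stabilizer of the last position, so
  the sum of the `C`-translates of any `ρ σ v` is a multiple of the sum of `v` over the whole
  group, which is zero because no nonzero vector is fixed by the whole group; and the vectors
  `ρ σ v` span.
-/

/-! ### Entries in the first row of a standard tableau -/

section

variable {n m : ℕ} {μ : YoungDiagram}

/-- A standard tableau is determined by the rows of its entries. -/
theorem IsStandard.eq_of_row_eq {T U : Fin n ≃ μ.cells} (hT : IsStandard T) (hU : IsStandard U)
    (h : ∀ a, (T a).1.1 = (U a).1.1) : T = U := by
  have key : ∀ (T U : Fin n ≃ μ.cells), IsStandard U → (∀ a, (T a).1.1 = (U a).1.1) →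
      ∀ a : Fin n, (∀ b < a, T b = U b) → ¬ (T a).1.2 < (U a).1.2 := by
    intro T U hU h a ih hlt
    -- The cell of `a` in `T` holds in `U` a smaller entry `c`, on which `T` and `U` agree.
    obtain ⟨c, hc⟩ := U.surjective (T a)
    have hca : c < a := hU.1 c a (by rw [hc, h a]) (by rw [hc]; exact hlt)
    rw [← ih c hca] at hc
    exact hca.ne (T.injective hc)
  ext a : 1
  induction a using WellFoundedLT.induction with
  | ind a ih =>
    have h1 := key T U hU h a ih
    have h2 := key U T hT (fun a => (h a).symm) a fun b hb => (ih b hb).symm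
    exact Subtype.ext (Prod.ext (h a) (by omega))

theorem IsStandard.le_col {T : Fin n ≃ μ.cells} (hT : IsStandard T) {a : Fin n}
    (h : ∀ b ≤ a, (T b).1.1 = 0) : (a : ℕ) ≤ (T a).1.2 := by
  have key : ∀ (k : ℕ) (b : Fin n), (b : ℕ) = k → b ≤ a → k ≤ (T b).1.2 := by
    intro k
    induction k with
    | zero => intros; omega
    | succ k ih =>
      intro b hb hba
      have hc : k < n := by omega
      have hcb : (⟨k, hc⟩ : Fin n) < b := by rw [Fin.lt_def]; simp; omega
      have h1 := ih ⟨k, hc⟩ rfl (hcb.le.trans hba)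
      have h2 : (T ⟨k, hc⟩).1.2 < (T b).1.2 := by
        by_contra hn
        have := hT.le_of_le (a := b) (b := ⟨k, hc⟩)
          (by rw [h b hba, h _ (hcb.le.trans hba)]) (by omega)
        exact absurd hcb (not_lt.2 this)
      omega
  exact key a a rfl le_rfl

theorem IsStandard.lt_rowLen {T : Fin n ≃ μ.cells} (hT : IsStandard T) {a : Fin n}
    (h : ∀ b ≤ a, (T b).1.1 = 0) : (a : ℕ) < μ.rowLen 0 := by
  refine (hT.le_col h).trans_lt (YoungDiagram.mem_iff_lt_rowLen.1 ?_)
  have := (T a).2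
  rw [YoungDiagram.mem_cells] at this
  rwa [← h a le_rfl]

/-! ### Young diagrams with long first row -/

theorem YoungDiagram.sum_rowLens (μ : YoungDiagram) : μ.rowLens.sum = μ.card := by
  have h : μ.rowLens.sum = ∑ i ∈ Finset.range (μ.colLen 0), μ.rowLen i := rfl
  rw [h, YoungDiagram.card,
    Finset.card_eq_sum_card_fiberwise (f := Prod.fst) (t := Finset.range (μ.colLen 0))]
  · exact Finset.sum_congr rfl fun i _ => μ.rowLen_eq_card
  · intro c hc
    rw [Finset.mem_coe, Finset.mem_range, ← YoungDiagram.mem_iff_lt_colLen]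
    exact μ.up_left_mem le_rfl (Nat.zero_le _) (show (c.1, c.2) ∈ μ from hc)

theorem YoungDiagram.rowLen_eq_getD (μ : YoungDiagram) (i : ℕ) :
    μ.rowLen i = μ.rowLens.getD i 0 := by
  by_cases h : i < μ.rowLens.length
  · rw [List.getD_eq_getElem _ _ h, YoungDiagram.get_rowLens]
  · rw [List.getD_eq_default _ _ (not_lt.1 h)]
    by_contra h0
    rw [YoungDiagram.length_rowLens, ← YoungDiagram.mem_iff_lt_colLen,
      YoungDiagram.mem_iff_lt_rowLen] at h
    omega

theorem col_lt (T : Fin n ≃ μ.cells) (a : Fin n) : (T a).1.2 < μ.rowLens.getD (T a).1.1 0 := by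
  rw [← YoungDiagram.rowLen_eq_getD, ← YoungDiagram.mem_iff_lt_rowLen]
  exact (T a).2

theorem rowLens_cases (hn : 1 ≤ n) (hμ : μ.card = n) (h : n - 2 ≤ μ.rowLen 0) :
    μ.rowLens = [n] ∨ μ.rowLens = [n - 1, 1] ∨ μ.rowLens = [n - 2, 2] ∨
      μ.rowLens = [n - 2, 1, 1] := by
  have hs := μ.sum_rowLens
  have hp := μ.pos_of_mem_rowLens
  have hh : ∀ x ∈ μ.rowLens.head?, n - 2 ≤ x := by
    intro x hx
    rw [YoungDiagram.rowLens, List.head?_map, List.head?_range] at hx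
    split_ifs at hx <;> simp at hx
    omega
  generalize μ.rowLens = l at *
  rw [hμ] at hs
  match l, hs, hp, hh with
  | [], hs, _, _ => simp at hs; omega
  | [a], hs, _, _ => left; simpa using hs
  | [a, b], hs, hp, hh =>
    simp at hs hp hh ⊢
    omega
  | [a, b, c], hs, hp, hh =>
    simp at hs hp hh ⊢
    omega
  | a :: b :: c :: d :: l, hs, hp, hh =>
    simp at hs hp hh ⊢
    omega

/-- The lexicographic order of the cells, row by row, is a standard tableau. -/
theorem nonempty_standardTableau (hμ : μ.card = n) : Nonempty (StandardTableau n μ) := by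
  have hcard : (μ.cells.map toLex.toEmbedding).card = n := by rw [Finset.card_map]; exact hμ
  let e := (μ.cells.map toLex.toEmbedding).orderIsoOfFin hcard
  have he : ∀ a, ofLex (e a).1 ∈ μ.cells := fun a => by
    obtain ⟨c, hc, h⟩ := Finset.mem_map.1 (e a).2
    rw [← h]
    exact hc
  let f : Fin n → μ.cells := fun a => ⟨ofLex (e a).1, he a⟩
  have hf : Function.Bijective f := by
    refine (Fintype.bijective_iff_injective_and_card f).2 ⟨fun a b h => ?_, ?_⟩
    · exact e.injective (Subtype.ext (congrArg (fun c : μ.cells => toLex c.1) h))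
    · simpa using hμ.symm
  have hlt : ∀ a b, toLex (f a).1 < toLex (f b).1 → a < b := fun a b h => e.lt_iff_lt.1 h
  refine ⟨⟨Equiv.ofBijective f hf, fun a b h1 h2 => hlt a b ?_, fun a b h1 h2 => hlt a b ?_⟩⟩
  · exact Prod.Lex.toLex_lt_toLex.2 (Or.inr ⟨h1, h2⟩)
  · exact Prod.Lex.toLex_lt_toLex.2 (Or.inl h2)

/-! ### Vectors fixed by the permutations of the first entries -/

/-- A vector fixed by the adjacent transpositions of the entries `0, …, q - 1` is supported on the
standard tableaux that have all these entries in the first row. -/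
theorem eq_zero_of_fixed {q : ℕ} {v : StandardTableau n μ → ℝ}
    (hv : ∀ i j : Fin n, (j : ℕ) = i + 1 → (j : ℕ) < q → (yorAdj μ i j).mulVec v = v)
    (T : StandardTableau n μ) {a : Fin n} (ha : (a : ℕ) < q) (hrow : (T.1 a).1.1 ≠ 0) :
    v T = 0 := by
  obtain ⟨k, hk⟩ : ∃ k, (a : ℕ) = k := ⟨_, rfl⟩
  induction k generalizing a T with
  | zero =>
    obtain ⟨c, hc⟩ := T.1.surjective ⟨(0, (T.1 a).1.2),
      μ.up_left_mem (Nat.zero_le _) le_rfl (show ((T.1 a).1.1, (T.1 a).1.2) ∈ μ from (T.1 a).2)⟩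
    have : c < a := T.2.2 c a (by rw [hc]) (by rw [hc]; simp; omega)
    rw [Fin.lt_def] at this
    omega
  | succ k ih =>
    have hkn : k < n := by omega
    set i : Fin n := ⟨k, hkn⟩ with hi
    have hij : (a : ℕ) = i + 1 := hk
    -- If the predecessor `i` of `a` is in row `0`, exchanging `i` and `a` reduces to `i`.
    by_cases h0 : (T.1 i).1.1 = 0
    · have hfix := congrFun (hv i a hij ha) T
      rw [yorAdj_mulVec hij] at hfix
      unfold yorFun at hfix
      rw [extendZero_coe] at hfix
      have hz : extendZero v (swapEntries i a T.1) = 0 := by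
        rw [extendZero]
        split_ifs with hs
        · exact ih ⟨_, hs⟩ (a := i) (by omega) (by simpa [swapEntries] using hrow) rfl
        · rfl
      rw [hz, mul_zero, add_zero] at hfix
      -- Content difference `1` would put the cell `(0, col a)` strictly between `i` and `a`.
      have hd : content T.1 a - content T.1 i ≠ 1 := by
        intro hd
        simp only [content, h0] at hd
        obtain ⟨c, hc⟩ := T.1.surjective ⟨(0, (T.1 a).1.2), μ.up_left_mem (Nat.zero_le _) le_rfl
          (show ((T.1 a).1.1, (T.1 a).1.2) ∈ μ from (T.1 a).2)⟩
        have h1 : c < a := T.2.2 c a (by rw [hc]) (by rw [hc]; simp; omega)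
        have h2 : i < c := T.2.1 i c (by rw [hc, h0]) (by rw [hc]; simp; omega)
        rw [Fin.lt_def] at h1 h2
        omega
      generalize content T.1 a - content T.1 i = d at *
      have hd' : (1 : ℝ) / (d : ℝ) ≠ 1 := by
        intro h
        rw [one_div, inv_eq_one] at h
        exact hd (by exact_mod_cast h)
      have : (1 / (d : ℝ) - 1) * v T = 0 := by linear_combination hfix
      exact (mul_eq_zero.1 this).resolve_left (sub_ne_zero.2 hd')
    · exact ih T (a := i) (by omega) h0 rfl

/-- The sum of Young's orthogonal representation over the permutations that fix every point
`i ≥ q`; up to a positive factor, the projection onto the vectors fixed by these permutations. -/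
noncomputable def stabSum (μ : YoungDiagram) (n q : ℕ) :
    Matrix (StandardTableau n μ) (StandardTableau n μ) ℝ :=
  ∑ σ : Equiv.Perm (Fin n) with ∀ i : Fin n, q ≤ i → σ i = i, yor n μ σ

theorem mul_stabSum_of_fixed {q : ℕ} {τ : Equiv.Perm (Fin n)} (hτ : ∀ i : Fin n, q ≤ i → τ i = i) :
    yor n μ τ * stabSum μ n q = stabSum μ n q := by
  unfold stabSum
  rw [Finset.mul_sum]
  refine Finset.sum_equiv (Equiv.mulLeft τ) (fun σ => ?_) fun σ _ => (map_mul _ _ _).symm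
  simp only [Finset.mem_filter, Finset.mem_univ, true_and, Equiv.coe_mulLeft,
    Equiv.Perm.mul_apply]
  refine forall₂_congr fun i hi => ⟨fun h => by rw [h, hτ i hi], fun h => ?_⟩
  exact τ.injective (by rw [h, hτ i hi])

/-- The rows of `stabSum μ n q * A` vanish except at the tableaux with `0, …, q - 1` in the first row. -/
theorem stabSum_mul_apply_eq_zero {q : ℕ} (A : Matrix (StandardTableau n μ) (StandardTableau n μ) ℝ)
    (T U : StandardTableau n μ) {a : Fin n} (ha : (a : ℕ) < q) (hrow : (T.1 a).1.1 ≠ 0) :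
    (stabSum μ n q * A) T U = 0 := by
  refine eq_zero_of_fixed (v := fun T => (stabSum μ n q * A) T U) (fun i j hij hj => ?_) T ha hrow
  rw [← yor_swap μ i j hij]
  have h := mul_stabSum_of_fixed (μ := μ) (q := q) (τ := Equiv.swap i j) fun x hx =>
    Equiv.swap_apply_of_ne_of_ne (by rintro rfl; omega) (by rintro rfl; omega)
  funext V
  conv_rhs => rw [← h, Matrix.mul_assoc]
  rfl

theorem stabSum_eq_zero {q : ℕ} (hq : q ≤ n) (h : μ.rowLen 0 < q) : stabSum μ n q = 0 := by
  ext T U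
  have : ∃ a : Fin n, (a : ℕ) < q ∧ (T.1 a).1.1 ≠ 0 := by
    by_contra! hn
    have := T.2.lt_rowLen (a := ⟨q - 1, by omega⟩) fun b hb => hn b (by
      rw [Fin.le_def] at hb; simp at hb; omega)
    simp at this
    omega
  obtain ⟨a, ha, hrow⟩ := this
  simpa using stabSum_mul_apply_eq_zero 1 T U ha hrow

/-! ### Factorization of the Fourier coefficient -/

/-- The sum of Young's orthogonal representation over all rotations of `Fin (m + 1)`. The index is
chosen such that the `i`-th rotation carries `i` to `m - 1` and `i + 1` to `m` (cyclically). -/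
noncomputable def cycleSum (m : ℕ) (μ : YoungDiagram) :
    Matrix (StandardTableau (m + 1) μ) (StandardTableau (m + 1) μ) ℝ :=
  ∑ i : Fin (m + 1), yor (m + 1) μ (Equiv.addRight (Fin.last m - 1 - i))

theorem fourierCoefficient_tspObjective (D : Matrix (Fin (m + 1)) (Fin (m + 1)) ℝ) :
    fourierCoefficient (tspObjective D) μ =
      (∑ τ : Equiv.Perm (Fin (m + 1)),
        D (τ (Fin.last m - 1)) (τ (Fin.last m)) • yor (m + 1) μ τ) * cycleSum m μ := by
  simp only [fourierCoefficient, tspObjective, Finset.sum_smul, cycleSum, Finset.mul_sum]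
  rw [Finset.sum_comm]
  refine Finset.sum_congr rfl fun i _ => ?_
  -- The rotation by `m - 1 - i` carries the consecutive pair `(i, i + 1)` to `(m - 1, m)`.
  rw [Finset.sum_mul, ← Equiv.sum_comp (Equiv.mulRight (Equiv.addRight (Fin.last m - 1 - i)))]
  refine Finset.sum_congr rfl fun τ _ => ?_
  have h : i + 1 + (Fin.last m - 1 - i) = Fin.last m := by abel
  rw [Matrix.smul_mul, ← map_mul, finRotate_apply]
  simp only [Equiv.coe_mulRight, Equiv.Perm.mul_apply, Equiv.coe_addRight, h, add_sub_cancel]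

/-- The two right factors do not depend on the instance `D`. -/
theorem fourierCoefficient_tspObjective_eq_mul_stabSum
    (D : Matrix (Fin (m + 1)) (Fin (m + 1)) ℝ) :
    ∃ B, fourierCoefficient (tspObjective D) μ =
      B * (stabSum μ (m + 1) (m - 1) * cycleSum m μ) := by
  set F := ∑ τ : Equiv.Perm (Fin (m + 1)),
        D (τ (Fin.last m - 1)) (τ (Fin.last m)) • yor (m + 1) μ τ with hF
  have hmul : ∀ h : Equiv.Perm (Fin (m + 1)), (∀ i : Fin (m + 1), m - 1 ≤ (i : ℕ) → h i = i) →
      F * yor (m + 1) μ h = F := by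
    intro h hh
    have h1 : h (Fin.last m) = Fin.last m := hh _ (by simp)
    have h2 : h (Fin.last m - 1) = Fin.last m - 1 := by
      refine hh _ ?_
      rcases m with _ | m
      · simp
      · have : (Fin.last (m + 1) - 1 : Fin (m + 2)) = (Fin.last m).castSucc := by
          rw [sub_eq_iff_eq_add, Fin.coeSucc_eq_succ, Fin.succ_last]
        rw [this]; simp
    rw [hF, Finset.sum_mul]
    refine Finset.sum_equiv (Equiv.mulRight h) (by simp) fun τ _ => ?_
    simp only [Equiv.coe_mulRight, Equiv.Perm.mul_apply, h1, h2, Matrix.smul_mul, map_mul]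
  -- As `F` absorbs the stabilizer, `F * stabSum` is `F` times the order of the stabilizer.
  have hs : F * stabSum μ (m + 1) (m - 1) =
      (Finset.card {σ : Equiv.Perm (Fin (m + 1)) | ∀ i : Fin (m + 1), m - 1 ≤ (i : ℕ) → σ i = i} : ℝ)
        • F := by
    rw [stabSum, Finset.mul_sum, Finset.sum_congr rfl fun σ hσ => hmul σ (Finset.mem_filter.1 hσ).2,
      Finset.sum_const, Nat.cast_smul_eq_nsmul]
  set N : ℝ := (Finset.card {σ : Equiv.Perm (Fin (m + 1)) | ∀ i : Fin (m + 1), m - 1 ≤ (i : ℕ) → σ i = i} : ℝ)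
  have hN : N ≠ 0 := by
    refine Nat.cast_ne_zero.2 (Finset.card_ne_zero.2 ⟨1, by simp⟩)
  refine ⟨N⁻¹ • F, ?_⟩
  rw [fourierCoefficient_tspObjective, ← hF, ← Matrix.mul_assoc, Matrix.smul_mul, hs, smul_smul,
    inv_mul_cancel₀ hN, one_smul]

/-! ### The partition `(n - 1, 1)` -/

/-- The stabilizer of the last point is generated by the adjacent transpositions that fix it. -/
theorem mem_of_swap_mem {m : ℕ} (S : Submonoid (Equiv.Perm (Fin (m + 1))))
    (hS : ∀ i j : Fin (m + 1), (j : ℕ) = i + 1 → (j : ℕ) < m → Equiv.swap i j ∈ S)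
    {σ : Equiv.Perm (Fin (m + 1))} (hσ : σ (Fin.last m) = Fin.last m) : σ ∈ S := by
  let e : Fin m ≃ {x : Fin (m + 1) // x ≠ Fin.last m} := finSuccAboveEquiv (Fin.last m)
  have he : ∀ a : Fin m, (e a : Fin (m + 1)) = a.castSucc := fun a =>
    Fin.succAbove_last_apply a
  let φ : Equiv.Perm (Fin m) →* Equiv.Perm (Fin (m + 1)) :=
    Equiv.Perm.ofSubtype.comp e.permCongrHom.toMonoidHom
  have hφ : ∀ a b : Fin m, φ (Equiv.swap a b) = Equiv.swap a.castSucc b.castSucc := by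
    intro a b
    have : e.permCongrHom (Equiv.swap a b) = Equiv.swap (e a) (e b) :=
      Equiv.symm_trans_swap_trans a b e
    simp only [φ, MonoidHom.comp_apply, MulEquiv.toMonoidHom_eq_coe, MonoidHom.coe_coe, this,
      Equiv.Perm.ofSubtype_swap_eq, he]
  have hmem : ∀ τ : Equiv.Perm (Fin m), φ τ ∈ S := by
    intro τ
    rcases m with _ | m
    · rw [Subsingleton.elim τ 1, map_one]
      exact S.one_mem
    · have hle : (⊤ : Submonoid (Equiv.Perm (Fin (m + 1)))) ≤ S.comap φ := by
        rw [← Equiv.Perm.mclosure_swap_castSucc_succ, Submonoid.closure_le]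
        rintro _ ⟨i, rfl⟩
        simp only [SetLike.mem_coe, Submonoid.mem_comap, hφ]
        exact hS _ _ (by simp) (by simp)
      exact hle (Submonoid.mem_top τ)
  have hp : ∀ x : Fin (m + 1), σ x ≠ Fin.last m ↔ x ≠ Fin.last m := fun x => by
    rw [not_iff_not]
    conv_lhs => rw [← hσ]
    exact σ.injective.eq_iff
  have hof : Equiv.Perm.ofSubtype (σ.subtypePerm hp) = σ :=
    Equiv.Perm.ofSubtype_subtypePerm (p := fun x => x ≠ Fin.last m) hp
      (by rintro x hx rfl; exact hx hσ)
  have := hmem (e.permCongrHom.symm (σ.subtypePerm hp))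
  simpa only [φ, MonoidHom.comp_apply, MulEquiv.toMonoidHom_eq_coe, MonoidHom.coe_coe,
    MulEquiv.apply_symm_apply, hof] using this

/-- If `v` is fixed by the stabilizer of the last point, `ρ σ v` depends only on the image of that
point under `σ`. The sum over all rotations then runs over all translates of `v`, and is a multiple
of the sum over the whole group. -/
theorem cycleSum_mulVec_eq_zero {v : StandardTableau (m + 1) μ → ℝ} (hμ : μ.rowLen 0 < m + 1)
    (hv : ∀ τ : Equiv.Perm (Fin (m + 1)), τ (Fin.last m) = Fin.last m →
      (yor (m + 1) μ τ).mulVec v = v) (σ : Equiv.Perm (Fin (m + 1))) :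
    (cycleSum m μ).mulVec ((yor (m + 1) μ σ).mulVec v) = 0 := by
  have hG : ∑ τ : Equiv.Perm (Fin (m + 1)), (yor (m + 1) μ τ).mulVec v = 0 := by
    have h := stabSum_eq_zero (n := m + 1) (μ := μ) le_rfl hμ
    rw [stabSum, Finset.filter_true_of_mem fun σ _ i hi => absurd i.2 (not_lt.2 hi)] at h
    rw [← Matrix.sum_mulVec, h, Matrix.zero_mulVec]
  -- `x a` is the common value of `τ v` for all `τ` with `τ m = a`.
  obtain ⟨x, hx⟩ : ∃ x : Fin (m + 1) → StandardTableau (m + 1) μ → ℝ,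
      ∀ τ, (yor (m + 1) μ τ).mulVec v = x (τ (Fin.last m)) := by
    refine ⟨fun a => (yor (m + 1) μ (Equiv.swap (Fin.last m) a)).mulVec v, fun τ => ?_⟩
    nth_rewrite 2 [← hv (Equiv.swap (Fin.last m) (τ (Fin.last m)) * τ) (by simp)]
    beta_reduce
    rw [Matrix.mulVec_mulVec, ← map_mul, ← mul_assoc, Equiv.swap_mul_self, one_mul]
  have hsum : ∑ a, x a = 0 := by
    have h1 : ∀ y : Fin (m + 1), ∑ τ : Equiv.Perm (Fin (m + 1)), x (τ y) = 0 := by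
      intro y
      rw [← hG, ← Equiv.sum_comp (Equiv.mulRight (Equiv.swap (Fin.last m) y))]
      refine Finset.sum_congr rfl fun τ _ => ?_
      rw [hx]
      simp
    have h2 : ∑ τ : Equiv.Perm (Fin (m + 1)), ∑ y, x (τ y) = 0 := by
      rw [Finset.sum_comm]
      exact Finset.sum_eq_zero fun y _ => h1 y
    simp only [Equiv.sum_comp, Finset.sum_const, smul_eq_zero] at h2
    exact h2.resolve_left (Finset.card_ne_zero.2 ⟨1, Finset.mem_univ _⟩)
  -- Any point is carried by the rotations to each point exactly once.
  rw [cycleSum, Matrix.sum_mulVec, ← hsum,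
    ← Equiv.sum_comp (Equiv.subLeft (σ (Fin.last m) + (Fin.last m - 1)))]
  refine Finset.sum_congr rfl fun i _ => ?_
  rw [Matrix.mulVec_mulVec, ← map_mul, hx]
  congr 1
  simp only [Equiv.Perm.mul_apply, Equiv.coe_addRight, Equiv.subLeft_apply]
  abel

/-- If the contents of `i` and `j` differ by more than one, the column of `yorAdj μ i j` at the tableau
`T'` obtained from `T` by the exchange combines `T'` and `T`, with nonzero coefficient at `T`. -/
theorem exists_yorAdj_col {i j : Fin n} (hij : i ≠ j) {T T' : StandardTableau n μ}
    (hT : T'.1 = swapEntries i j T.1) (hd : 1 < |content T.1 j - content T.1 i|) :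
    ∃ c s : ℝ, s ≠ 0 ∧ (yorAdj μ i j).mulVec (Pi.single T' 1) =
      c • Pi.single T' 1 + s • Pi.single T 1 := by
  have hne : T' ≠ T := fun h => swapEntries_ne hij T.1 (by rw [← hT, h])
  refine ⟨yorAdj μ i j T' T', yorAdj μ i j T T', ?_, ?_⟩
  · simp only [yorAdj, Matrix.of_apply, if_neg hne, if_pos hT]
    refine (Real.sqrt_pos.2 (sub_pos.2 ?_)).ne'
    have h2 : (1 : ℝ) < ((content T.1 j - content T.1 i : ℤ) : ℝ) ^ 2 := by
      rw [one_lt_sq_iff_one_lt_abs]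
      exact_mod_cast hd
    rwa [one_div, inv_lt_one₀ (by positivity)]
  · rw [Matrix.mulVec_single_one]
    funext U
    simp only [Matrix.col_apply, Pi.add_apply, Pi.smul_apply, smul_eq_mul]
    by_cases h1 : U = T'
    · subst h1; simp [hne]
    by_cases h2 : U = T
    · subst h2; simp [h1]
    have h3 : ¬ T'.1 = swapEntries i j U.1 := by
      intro h
      rw [hT] at h
      apply h2
      rw [Subtype.ext_iff, ← swapEntries_swapEntries i j U.1, ← h, swapEntries_swapEntries]
    simp [h1, h2, yorAdj, h3, Ne.symm h1]

theorem yorAdj_mulVec_single_of_row_eq {i j : Fin n} (hij : (j : ℕ) = i + 1)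
    {T : StandardTableau n μ} (h : (T.1 i).1.1 = (T.1 j).1.1) :
    (yorAdj μ i j).mulVec (Pi.single T 1) = Pi.single T 1 := by
  have hlt : i < j := by rw [Fin.lt_def]; omega
  have hcol : (T.1 i).1.2 < (T.1 j).1.2 := by
    by_contra hn
    exact absurd hlt (not_lt.2 (T.2.le_of_le h.ge (not_lt.1 hn)))
  have hs : ¬ IsStandard (swapEntries i j T.1) := fun hs => by
    refine lt_asymm hlt (hs.1 j i ?_ ?_) <;> simp [swapEntries, h, hcol]
  have hd : content T.1 j - content T.1 i = 1 := by
    rcases T.2.content_sub_of_not hij hs with hd | hd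
    · exact hd
    · simp only [content] at hd
      omega
  rw [Matrix.mulVec_single_one]
  funext U
  simp only [Matrix.col_apply, yorAdj, Matrix.of_apply]
  by_cases h1 : T = U
  · subst h1; simp [hd]
  · have h3 : ¬ T.1 = swapEntries i j U.1 := fun h => hs (by
      rw [h, swapEntries_swapEntries]; exact U.2)
    simp [h1, Ne.symm h1, h3]

/-- The space of vectors `v` with `C (ρ σ v) = 0` for all `σ`, where `C` is the sum over the rotations,
contains the tableau with the last entry in the second row, and with it all other tableaux, as they
are reached from there by adjacent exchanges. -/
theorem cycleSum_eq_zero (hμ : μ.rowLens = [m, 1]) : cycleSum m μ = 0 := by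
  have hcell : ∀ (T : Fin (m + 1) ≃ μ.cells) a, (T a).1.1 ≠ 0 → (T a).1.1 = 1 ∧ (T a).1.2 = 0 := by
    intro T a h
    have := col_lt T a
    rw [hμ] at this
    match hr : (T a).1.1, h, this with
    | 1, _, this => simpa using this
    | r + 2, _, this => simp at this
  have huniq : ∀ (T : Fin (m + 1) ≃ μ.cells) a b, (T a).1.1 ≠ 0 → (T b).1.1 ≠ 0 → a = b := by
    intro T a b ha hb
    refine T.injective (Subtype.ext (Prod.ext ?_ ?_))
    · rw [(hcell T a ha).1, (hcell T b hb).1]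
    · rw [(hcell T a ha).2, (hcell T b hb).2]
  -- Induction on the distance of the entry `a` of the second row from the last entry `m`.
  have key : ∀ (k : ℕ) (T : StandardTableau (m + 1) μ) (a : Fin (m + 1)), (a : ℕ) + k = m →
      (T.1 a).1.1 ≠ 0 → ∀ σ, (cycleSum m μ).mulVec
        ((yor (m + 1) μ σ).mulVec (Pi.single T 1)) = 0 := by
    intro k
    induction k with
    | zero =>
      intro T a ha hrow
      refine cycleSum_mulVec_eq_zero (by rw [YoungDiagram.rowLen_eq_getD, hμ]; simp) fun τ hτ => ?_
      let S : Submonoid (Equiv.Perm (Fin (m + 1))) :=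
        { carrier := {τ | (yor (m + 1) μ τ).mulVec (Pi.single T 1) = Pi.single T 1}
          one_mem' := by
            rw [Set.mem_ofPred_eq, map_one, Matrix.one_mulVec]
          mul_mem' := fun {x y} hx hy => by
            simp only [Set.mem_ofPred_eq] at hx hy ⊢
            rw [map_mul, ← Matrix.mulVec_mulVec, hy, hx] }
      refine mem_of_swap_mem S (fun i j hij hj => ?_) hτ
      change (yor (m + 1) μ (Equiv.swap i j)).mulVec (Pi.single T 1) = Pi.single T 1
      have h0 : ∀ b : Fin (m + 1), (b : ℕ) < m → (T.1 b).1.1 = 0 := by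
        intro b hb
        by_contra h
        have := huniq T.1 a b hrow h
        omega
      rw [yor_swap μ i j hij]
      exact yorAdj_mulVec_single_of_row_eq hij (by rw [h0 i (by omega), h0 j hj])
    | succ k ih =>
      intro T a ha hrow σ
      obtain ⟨j, hj⟩ : ∃ j : Fin (m + 1), (j : ℕ) = a + 1 := ⟨⟨a + 1, by omega⟩, rfl⟩
      have haj : a ≠ j := by rintro rfl; omega
      have hj0 : (T.1 j).1.1 = 0 := by
        by_contra h
        exact haj (huniq T.1 a j hrow h)
      obtain ⟨h1, h2⟩ := hcell T.1 a hrow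
      have hcol : (T.1 j).1.2 ≠ 0 := fun h => by
        have := T.2.le_of_le (a := j) (b := a) (by omega) (by omega)
        rw [Fin.le_def] at this
        omega
      have hd : 1 < content T.1 j - content T.1 a := by
        simp only [content, h1, h2, hj0]
        omega
      have hs : IsStandard (swapEntries a j T.1) := by
        by_contra hs
        rcases T.2.content_sub_of_not hj hs with h | h <;> omega
      have hIH := ih ⟨_, hs⟩ j (by omega) (by simpa [swapEntries] using hrow)
      obtain ⟨c, s, hs0, hcs⟩ := exists_yorAdj_col haj (T := T) (T' := ⟨_, hs⟩) rfl
        (hd.trans_le (le_abs_self _))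
      have h3 := hIH (σ * Equiv.swap a j)
      rw [map_mul, ← Matrix.mulVec_mulVec, yor_swap μ a j hj, hcs, Matrix.mulVec_add,
        Matrix.mulVec_add, Matrix.mulVec_smul, Matrix.mulVec_smul, Matrix.mulVec_smul,
        Matrix.mulVec_smul, hIH σ, smul_zero, zero_add, smul_eq_zero] at h3
      exact h3.resolve_left hs0
  ext U T
  have hm : (1, 0) ∈ μ := by
    rw [YoungDiagram.mem_iff_lt_rowLen, YoungDiagram.rowLen_eq_getD, hμ]
    simp
  obtain ⟨a, ha⟩ := T.1.surjective ⟨(1, 0), hm⟩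
  have := key (m - a) T a (by omega) (by rw [ha]; simp) 1
  rw [map_one, Matrix.one_mulVec, Matrix.mulVec_single_one] at this
  exact congrFun this U

/-! ### The partitions `(n - 2, 2)` and `(n - 2, 1, 1)` -/

theorem IsStandard.row_ne_zero {T : Fin n ≃ μ.cells} (hT : IsStandard T) {q : ℕ}
    (hq : μ.rowLen 0 ≤ q) (h : ∀ b : Fin n, (b : ℕ) < q → (T b).1.1 = 0) {a : Fin n}
    (ha : q ≤ a) : (T a).1.1 ≠ 0 := by
  intro h0
  have hcol := col_lt T a
  rw [← YoungDiagram.rowLen_eq_getD, h0] at hcol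
  obtain ⟨k, rfl⟩ : ∃ k, q = k + 1 := ⟨q - 1, by omega⟩
  have hk : k < n := by omega
  have h1 := hT.le_col (a := ⟨k, hk⟩) fun b hb => h b (by
    rw [Fin.le_def] at hb; simp at hb; omega)
  have h2 : (T ⟨k, hk⟩).1.2 < (T a).1.2 := by
    by_contra hn
    have := hT.le_of_le (a := a) (b := ⟨k, hk⟩) (by rw [h0]; omega) (not_lt.1 hn)
    rw [Fin.le_def] at this
    simp at this
    omega
  simp at h1
  omega

/-- For `(n - 2, 2)` and `(n - 2, 1, 1)` there is only one standard tableau with `0, …, n - 3` in the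
first row. -/
theorem IsStandard.eq_of_first_row {T U : Fin (m + 1) ≃ μ.cells} (hT : IsStandard T)
    (hU : IsStandard U) (hμ : μ.rowLens = [m - 1, 2] ∨ μ.rowLens = [m - 1, 1, 1])
    (hT0 : ∀ a : Fin (m + 1), (a : ℕ) < m - 1 → (T a).1.1 = 0)
    (hU0 : ∀ a : Fin (m + 1), (a : ℕ) < m - 1 → (U a).1.1 = 0) : T = U := by
  have hlen : μ.rowLen 0 = m - 1 := by
    rw [YoungDiagram.rowLen_eq_getD]
    rcases hμ with h | h <;> simp [h]
  have hm : 0 < m - 1 := by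
    refine μ.pos_of_mem_rowLens _ ?_
    rcases hμ with h | h <;> simp [h]
  have key : ∀ T : Fin (m + 1) ≃ μ.cells, IsStandard T →
      (∀ a : Fin (m + 1), (a : ℕ) < m - 1 → (T a).1.1 = 0) → ∀ a : Fin (m + 1), m - 1 ≤ (a : ℕ) →
      (T a).1.1 = if μ.rowLens = [m - 1, 2] then 1 else (a : ℕ) + 2 - m := by
    intro T hT h0 a ha
    have hrow : ∀ b : Fin (m + 1), m - 1 ≤ (b : ℕ) → (T b).1.1 ≠ 0 :=
      fun b hb => hT.row_ne_zero hlen.le h0 hb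
    split_ifs with hs
    · have h1 := hrow a ha
      have h2 := col_lt T a
      rw [hs] at h2
      match hr : (T a).1.1, h1, h2 with
      | 1, _, _ => rfl
      | r + 2, _, h2 => simp at h2
    · have hs' := hμ.resolve_left hs
      have hc : ∀ b : Fin (m + 1), m - 1 ≤ (b : ℕ) →
          ((T b).1.1 = 1 ∨ (T b).1.1 = 2) ∧ (T b).1.2 = 0 := by
        intro b hb
        have h1 := hrow b hb
        have h2 := col_lt T b
        rw [hs'] at h2
        match hr : (T b).1.1, h1, h2 with
        | 1, _, h2 => simpa using h2
        | 2, _, h2 => simpa using h2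
        | r + 3, _, h2 => simp at h2
      -- The last two entries `m - 1`, `m` are one below the other in column `0`.
      obtain ⟨p, hp⟩ : ∃ p : Fin (m + 1), (p : ℕ) = m - 1 := ⟨⟨m - 1, by omega⟩, rfl⟩
      have hlt : (T p).1.1 < (T (Fin.last m)).1.1 := by
        by_contra hn
        have := hT.le_of_le (a := Fin.last m) (b := p) (not_lt.1 hn)
          (by rw [(hc _ hp.ge).2, (hc (Fin.last m) (by simp)).2])
        rw [Fin.le_def, Fin.val_last] at this
        omega
      have h1 := (hc p hp.ge).1
      have h2 := (hc (Fin.last m) (by simp)).1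
      rcases Nat.lt_or_ge (a : ℕ) m with hlt' | hge
      · have : a = p := Fin.ext (by omega)
        rw [this]
        omega
      · have : a = Fin.last m := Fin.ext (by rw [Fin.val_last]; omega)
        rw [this, Fin.val_last]
        omega
  refine hT.eq_of_row_eq hU fun a => ?_
  rcases Nat.lt_or_ge (a : ℕ) (m - 1) with h | h
  · rw [hT0 a h, hU0 a h]
  · rw [key T hT hT0 a h, key U hU hU0 a h]

theorem exists_vecMulVec (hcard : μ.card = m + 1)
    (hμ : μ.rowLens = [m - 1, 2] ∨ μ.rowLens = [m - 1, 1, 1]) :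
    ∃ a : StandardTableau (m + 1) μ → ℝ, a ≠ 0 ∧ ∀ D : Matrix (Fin (m + 1)) (Fin (m + 1)) ℝ,
      ∃ w, fourierCoefficient (tspObjective D) μ = Matrix.vecMulVec w a := by
  have hne := nonempty_standardTableau hcard
  have hrow : ∃ a : StandardTableau (m + 1) μ → ℝ, ∃ u,
      stabSum μ (m + 1) (m - 1) * cycleSum m μ = Matrix.vecMulVec u a := by
    by_cases hex : ∃ T : StandardTableau (m + 1) μ,
        ∀ a : Fin (m + 1), (a : ℕ) < m - 1 → (T.1 a).1.1 = 0
    · obtain ⟨T, hT⟩ := hex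
      refine ⟨(stabSum μ (m + 1) (m - 1) * cycleSum m μ) T, Pi.single T 1, ?_⟩
      ext U V
      rw [Matrix.vecMulVec_apply]
      by_cases hU : U = T
      · simp [hU]
      · rw [Pi.single_eq_of_ne hU, zero_mul]
        by_contra h0
        refine hU (Subtype.ext (U.2.eq_of_first_row T.2 hμ (fun a ha => ?_) hT))
        by_contra h
        exact h0 (stabSum_mul_apply_eq_zero _ U V ha h)
    · refine ⟨0, 0, ?_⟩
      push Not at hex
      ext U V
      obtain ⟨a, ha, h⟩ := hex U
      simpa using stabSum_mul_apply_eq_zero _ U V ha h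
  obtain ⟨a, u, hau⟩ := hrow
  -- If the common row is zero, all coefficients vanish, and any nonzero row will do.
  by_cases ha : a = 0
  · refine ⟨1, one_ne_zero, fun D => ⟨0, ?_⟩⟩
    obtain ⟨B, hB⟩ := fourierCoefficient_tspObjective_eq_mul_stabSum (μ := μ) D
    rw [hB, hau, ha, Matrix.vecMulVec_zero, Matrix.mul_zero, Matrix.zero_vecMulVec]
  · refine ⟨a, ha, fun D => ?_⟩
    obtain ⟨B, hB⟩ := fourierCoefficient_tspObjective_eq_mul_stabSum (μ := μ) D
    exact ⟨B.mulVec u, by rw [hB, hau, Matrix.mul_vecMulVec]⟩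

/-! ### Fourier coefficients of tour lengths -/

theorem fourierCoefficient_tspObjective_eq_zero (hμ : μ.card = m + 1) (h1 : μ.rowLens ≠ [m + 1])
    (h2 : μ.rowLens ≠ [m - 1, 2]) (h3 : μ.rowLens ≠ [m - 1, 1, 1])
    (D : Matrix (Fin (m + 1)) (Fin (m + 1)) ℝ) : fourierCoefficient (tspObjective D) μ = 0 := by
  obtain ⟨B, hB⟩ := fourierCoefficient_tspObjective_eq_mul_stabSum (μ := μ) D
  rw [hB]
  rcases Nat.lt_or_ge (μ.rowLen 0) (m - 1) with h | h
  · rw [stabSum_eq_zero (by omega) h, Matrix.zero_mul, Matrix.mul_zero]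
  · rcases rowLens_cases (by omega) hμ h with h | h | h | h
    · exact absurd h h1
    · rw [cycleSum_eq_zero (by simpa using h), Matrix.mul_zero, Matrix.mul_zero]
    · exact absurd h h2
    · exact absurd h h3

end

theorem theorem2 (n : ℕ) (hn : 1 ≤ n) (μ : YoungDiagram) (hμ : μ.card = n) :
    ((μ.rowLens ≠ [n] ∧ μ.rowLens ≠ [n - 2, 2] ∧ μ.rowLens ≠ [n - 2, 1, 1]) →
      ∀ D : Matrix (Fin n) (Fin n) ℝ, fourierCoefficient (tspObjective D) μ = 0) ∧
    ((μ.rowLens = [n - 2, 2] ∨ μ.rowLens = [n - 2, 1, 1]) →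
      (∀ D : Matrix (Fin n) (Fin n) ℝ, (fourierCoefficient (tspObjective D) μ).rank ≤ 1) ∧
      ∃ a : StandardTableau n μ → ℝ, a ≠ 0 ∧ ∀ D : Matrix (Fin n) (Fin n) ℝ,
        ∃ w : StandardTableau n μ → ℝ,
          fourierCoefficient (tspObjective D) μ = Matrix.vecMulVec w a) := by
  obtain ⟨m, rfl⟩ : ∃ m, n = m + 1 := ⟨n - 1, by omega⟩
  refine ⟨fun h D => fourierCoefficient_tspObjective_eq_zero hμ h.1 h.2.1 h.2.2 D, fun h => ?_⟩
  obtain ⟨a, ha, H⟩ := exists_vecMulVec hμ h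
  refine ⟨fun D => ?_, a, ha, H⟩
  obtain ⟨w, hw⟩ := H D
  rw [hw]
  exact Matrix.rank_vecMulVec_le w a
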